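/- **Theorem 2.2.** All graphs are finite and simple. Let $G$ be a graph on $n\ge 5$ vertices such that $d_G(u)+d_G(v)\ge n$ for every pair of distinct nonadjacent vertices $u,v$ (Ore's condition). Then $G$ is Hamiltonian. An *$H$-force set* of $G$ is a nonempty set $X\subseteq V(G)$ such that every cycle of $G$ containing all vertices of $X$ is a Hamiltonian cycle; the *$H$-force number* $h(G)$ is the smallest cardinality of an $H$-force set, and an $H$-force set with $h(G)$ elements is called *minimum*. Let the *weak closure* $C_w(G)$ be the graph obtained from $G$ by recursively joining pairs of distinct nonadjacent vertices whose degree sum (in the current graph) is at least $n+1$, until no such pair remains (the result does not depend on the order of the joins). Then: (1) $h(G)\in\{\,n-2,\ \tfrac n2,\ n\,\}$. (2) The minimum $H$-force sets of $G$ are as follows. - If $h(G)=n-2$, then $C_w(G)$ has exactly two vertices $x,y$ of degree $n-1$, and $V(G)\setminus\{x,y\}$ is the unique minimum $H$-force set of $G$. - If $h(G)=\tfrac n2$, then a set $X\subseteq V(G)$ is a minimum $H$-force set of $G$ if and only if $X$ is a largest independent set of $C_w(G)$ (an independent set of maximum cardinality). - If $h(G)=n$, then $V(G)$ is the unique minimum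 $H$-force set of $G$. -/

import Mathlib

namespace HForce

variable {V : Type*}

/-- The degree of the vertex `v` in `G`: the number of its neighbours. -/
noncomputable def deg (G : SimpleGraph V) (v : V) : ℕ := (G.neighborSet v).ncard

/-- Ore's condition: `d(u) + d(v) ≥ n` for every pair of distinct nonadjacent vertices. -/
def IsOTG [Fintype V] (G : SimpleGraph V) : Prop :=
  ∀ u v : V, u ≠ v → ¬ G.Adj u v → Fintype.card V ≤ deg G u + deg G v

/-- `X` is an `H`-force set of `G`: it is nonempty, and every cycle of `G` through all vertices of
`X` is a Hamiltonian cycle. -/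
def IsHForceSet [DecidableEq V] (G : SimpleGraph V) (X : Finset V) : Prop :=
  X.Nonempty ∧ ∀ (v : V) (c : G.Walk v v), c.IsCycle → (∀ x ∈ X, x ∈ c.support) →
    c.IsHamiltonianCycle

/-- The `H`-force number: the smallest cardinality of an `H`-force set. (The whole vertex set is
always an `H`-force set if there is a vertex.) -/
noncomputable def hForceNumber [DecidableEq V] (G : SimpleGraph V) : ℕ :=
  sInf {k | ∃ X : Finset V, IsHForceSet G X ∧ X.card = k}

/-- `X` is a minimum `H`-force set: an `H`-force set such that no `H`-force set is smaller. -/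
def IsMinHForceSet [DecidableEq V] (G : SimpleGraph V) (X : Finset V) : Prop :=
  IsHForceSet G X ∧ ∀ Y : Finset V, IsHForceSet G Y → X.card ≤ Y.card

/-- `u`, `v` are distinct nonadjacent vertices of degree sum at least `n + 1`. -/
def IsJoinable [Fintype V] (G : SimpleGraph V) (u v : V) : Prop :=
  u ≠ v ∧ ¬ G.Adj u v ∧ Fintype.card V + 1 ≤ deg G u + deg G v

/-- `H` arises from `G` by joining one pair of nonadjacent vertices of degree sum at least
`n + 1`. -/
def JoinStep [Fintype V] (G H : SimpleGraph V) : Prop :=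
  ∃ u v : V, IsJoinable G u v ∧ H = G ⊔ SimpleGraph.edge u v

/-- `H` is obtained from `G` by recursively joining pairs of nonadjacent vertices whose degree sum
is at least `n + 1` until no such pair remains. -/
def IsWeakClosure [Fintype V] (G H : SimpleGraph V) : Prop :=
  Relation.ReflTransGen JoinStep G H ∧ ∀ u v : V, ¬ IsJoinable H u v

theorem deg_mono [Fintype V] {G H : SimpleGraph V} (h : G ≤ H) (v : V) : deg G v ≤ deg H v :=
  Set.ncard_le_ncard (fun _ hw => h hw) (Set.toFinite _)

theorem JoinStep.lt [Fintype V] {G H : SimpleGraph V} (h : JoinStep G H) : G < H := by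
  obtain ⟨u, v, ⟨hne, hna, -⟩, rfl⟩ := h
  refine lt_of_le_of_ne le_sup_left fun he => hna ?_
  rw [he]
  exact Or.inr (by simp [SimpleGraph.edge_adj, hne])

theorem exists_isWeakClosure [Fintype V] (G : SimpleGraph V) : ∃ H, IsWeakClosure G H := by
  induction G using (Finite.wellFounded_of_trans_of_irrefl
    (fun G H : SimpleGraph V => H < G)).induction with
  | _ G ih =>
    by_cases hG : ∃ u v, IsJoinable G u v
    · obtain ⟨u, v, huv⟩ := hG
      have hs : JoinStep G (G ⊔ SimpleGraph.edge u v) := ⟨u, v, huv, rfl⟩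
      obtain ⟨H, hH, hc⟩ := ih _ hs.lt
      exact ⟨H, hH.head hs, hc⟩
    · exact ⟨G, .refl, fun u v h => hG ⟨u, v, h⟩⟩

/-- A graph reached from `G` by joining steps lies below every weak closure of `G`. -/
theorem IsWeakClosure.le_of_reach [Fintype V] {G H K : SimpleGraph V} (hH : IsWeakClosure G H)
    (hK : Relation.ReflTransGen JoinStep G K) : K ≤ H := by
  induction hK with
  | refl =>
    have aux : ∀ L, Relation.ReflTransGen JoinStep G L → G ≤ L := by
      intro L hL
      induction hL with
      | refl => exact le_rfl
      | tail _ hs ih => exact ih.trans hs.lt.le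
    exact aux H hH.1
  | tail _ hs ih =>
    obtain ⟨u, v, ⟨hne, -, hd⟩, rfl⟩ := hs
    refine sup_le ih ?_
    rw [SimpleGraph.edge_le_iff]
    right
    by_contra hna
    exact hH.2 u v ⟨hne, hna, hd.trans (add_le_add (deg_mono ih u) (deg_mono ih v))⟩

/-- The weak closure is well defined: the result does not depend on the order of the joins. -/
theorem IsWeakClosure.unique [Fintype V] {G H K : SimpleGraph V} (hH : IsWeakClosure G H)
    (hK : IsWeakClosure G K) : H = K :=
  le_antisymm (hK.le_of_reach hH.1) (hH.le_of_reach hK.1)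

/-- The weak closure `C_w(G)`. -/
noncomputable def weakClosure [Fintype V] (G : SimpleGraph V) : SimpleGraph V :=
  Classical.choose (exists_isWeakClosure G)

theorem weakClosure_spec [Fintype V] (G : SimpleGraph V) : IsWeakClosure G (weakClosure G) :=
  Classical.choose_spec (exists_isWeakClosure G)

end HForce

/-!
Let `H` be the weak closure of `G`. Nonadjacent vertices of `H` have degree sum exactly `n`: at
least `n` by Ore's condition, at most `n` because nothing can be joined any more. The closure
lemma of Bondy and Chvátal (`hasSpanningCycle_of_sup_edge`), applied to the vertex-deleted
subgraphs, shows that `G - v` is Hamiltonian if and only if `H - v` is;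
`IsWeakClosure.hasSpanningCycle_erase` is the nontrivial direction. A vertex `v` with `G - v`
Hamiltonian belongs to every H-force set.

The heart of the proof is `separatingPair_or_indepSet`: if `H - v` is not Hamiltonian, then `v`
lies in a separating pair of `H`, or `H` has an independent set of `n / 2` vertices that avoids
`v`. Indeed `H - v` has a Hamiltonian path `f 0, …, f (m - 1)`, and as its ends have a degree sum
as large as nonhamiltonicity permits, exactly one of `f 0 ~ f (i + 1)` and `f (m - 1) ~ f i`
holds for each `i`. If the neighbours of `f 0` form an initial segment of the rest of the path,
the last of them separates `H - v`. Otherwise there is a cycle through all vertices of `H - v` but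
one vertex `z`. If `z` has only one neighbour `y` on it, then `v`, `y` separate `z` from the rest;
if it has more, the successors on the cycle of the neighbours of `z` form together with `z` an
independent set, and the degree sums force it to have `n / 2` vertices.

This leaves three cases.

* If `H` has a separating pair `x`, `y`, then `H - x - y` consists of two complete graphs
  completely joined to the adjacent vertices `x` and `y`. A cycle through all other vertices must
  use both `x` and `y`, and `H - a` satisfies Ore's condition for each other vertex `a`. So the
  complement of `{x, y}` is the least H-force set.
* If `H` has no separating pair but an independent set `I` of `n / 2` vertices, then `I` is an
  H-force set, since a cycle through `I` has at least `n` vertices. Conversely each H-force set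
  contains such an independent set (`IsHForceSet.exists_isIndepSet_subset`): it contains `I`,
  unless the complement of `I` is independent too; then `G` is complete bipartite, and a set that
  misses a vertex of each class lies on a cycle of length `n - 2`.
* Otherwise each `G - v` is Hamiltonian, and the whole vertex set is the only H-force set.

Paths and cycles that span a set `S` are handled as functions `ℕ → V` on the indices below the
cardinality of `S`, so that reversing and exchanging segments becomes reindexing.
-/

namespace HForce

/-! ### Spanning paths and cycles of induced subgraphs -/

variable {V : Type*}

/-- `f 0, f 1, …, f (#S - 1)` is a path of `G` that runs through the vertices of `S` exactly once.
The values of `f` from `#S` on are irrelevant. -/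
structure IsSpanningPath (G : SimpleGraph V) (S : Finset V) (f : ℕ → V) : Prop where
  mem : ∀ i < S.card, f i ∈ S
  inj : ∀ i < S.card, ∀ j < S.card, f i = f j → i = j
  adj : ∀ i, i + 1 < S.card → G.Adj (f i) (f (i + 1))

/-- The subgraph of `G` induced by `S` has a Hamiltonian cycle, given as a spanning path with
adjacent ends. -/
def HasSpanningCycle (G : SimpleGraph V) (S : Finset V) : Prop :=
  3 ≤ S.card ∧ ∃ f, IsSpanningPath G S f ∧ G.Adj (f (S.card - 1)) (f 0)

open Classical in
/-- The number of neighbours of `v` in `S`. -/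
noncomputable def degOn (G : SimpleGraph V) (S : Finset V) (v : V) : ℕ :=
  (S.filter (G.Adj v)).card

variable {G : SimpleGraph V} {S : Finset V} {f : ℕ → V}

theorem IsSpanningPath.surj (hf : IsSpanningPath G S f) {v : V} (hv : v ∈ S) :
    ∃ i < S.card, f i = v := by
  classical
  have h : (Finset.range S.card).image f = S := by
    refine Finset.eq_of_subset_of_card_le ?_ ?_
    · intro x hx
      obtain ⟨i, hi, rfl⟩ := Finset.mem_image.1 hx
      exact hf.mem i (Finset.mem_range.1 hi)
    · rw [Finset.card_image_of_injOn, Finset.card_range]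
      intro i hi j hj hij
      exact hf.inj i (by simpa using hi) j (by simpa using hj) hij
  rw [← h] at hv
  obtain ⟨i, hi, rfl⟩ := Finset.mem_image.1 hv
  exact ⟨i, Finset.mem_range.1 hi, rfl⟩

/-- Visiting the vertices of a spanning path in another order `σ`. -/
theorem IsSpanningPath.reindex {G' : SimpleGraph V} (hf : IsSpanningPath G S f) (σ : ℕ → ℕ)
    (hσ : ∀ i < S.card, σ i < S.card)
    (hinj : ∀ i < S.card, ∀ j < S.card, σ i = σ j → i = j)
    (hadj : ∀ i, i + 1 < S.card → G'.Adj (f (σ i)) (f (σ (i + 1)))) :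
    IsSpanningPath G' S (fun i => f (σ i)) where
  mem i hi := hf.mem _ (hσ i hi)
  inj i hi j hj h := hinj i hi j hj (hf.inj _ (hσ i hi) _ (hσ j hj) h)
  adj := hadj

theorem IsSpanningPath.adj' (hf : IsSpanningPath G S f) {i j : ℕ} (hi : i < S.card)
    (hj : j < S.card) (h : j = i + 1 ∨ i = j + 1) : G.Adj (f i) (f j) := by
  rcases h with rfl | rfl
  · exact hf.adj _ hj
  · exact (hf.adj _ hi).symm

theorem IsSpanningPath.adj_cyclic (hf : IsSpanningPath G S f) (hc : G.Adj (f (S.card - 1)) (f 0))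
    {i j : ℕ} (hi : i < S.card) (hj : j < S.card) (h : j = i + 1 ∨ i = S.card - 1 ∧ j = 0) :
    G.Adj (f i) (f j) := by
  rcases h with rfl | ⟨rfl, rfl⟩
  · exact hf.adj _ hj
  · exact hc

/-- The cyclic shift by `r` of the indices below `m`. -/
def shift (m r i : ℕ) : ℕ := if i + r < m then i + r else i + r - m

/-- A spanning cycle can be opened at any vertex. -/
theorem IsSpanningPath.rotate (hf : IsSpanningPath G S f) (hc : G.Adj (f (S.card - 1)) (f 0))
    {r : ℕ} (hr : r < S.card) :
    IsSpanningPath G S (fun i => f (shift S.card r i)) ∧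
      G.Adj (f (shift S.card r (S.card - 1))) (f (shift S.card r 0)) := by
  refine ⟨hf.reindex _ ?_ ?_ ?_, hf.adj_cyclic hc ?_ ?_ ?_⟩
  · intro i hi; unfold shift; split_ifs <;> omega
  · intro i hi j hj; unfold shift; split_ifs <;> omega
  · intro i hi
    refine hf.adj_cyclic hc ?_ ?_ ?_ <;> unfold shift <;> split_ifs <;> omega
  all_goals unfold shift; split_ifs <;> omega

/-- The crossing argument: if the first vertex of a spanning path is adjacent to the successor of a
neighbour of the last vertex, then the path can be closed to a spanning cycle. -/
theorem IsSpanningPath.hasSpanningCycle_of_crossing (hf : IsSpanningPath G S f) (hS : 3 ≤ S.card)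
    {i : ℕ} (hi : i + 1 < S.card) (h0 : G.Adj (f 0) (f (i + 1)))
    (h1 : G.Adj (f (S.card - 1)) (f i)) : HasSpanningCycle G S := by
  refine ⟨hS, _, hf.reindex (fun t => if t ≤ i then t else S.card + i - t) ?_ ?_ ?_, ?_⟩
  · intro t ht; split_ifs <;> omega
  · intro s hs t ht; split_ifs <;> omega
  · intro t ht
    by_cases hti : t = i
    · subst hti
      simp only [le_refl, if_true, show ¬ t + 1 ≤ t by omega, if_false]
      rw [show S.card + t - (t + 1) = S.card - 1 by omega]
      exact h1.symm
    · refine hf.adj' ?_ ?_ ?_ <;> split_ifs <;> omega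
  · simp only [show ¬ S.card - 1 ≤ i by omega, if_false, zero_le, if_true]
    rw [show S.card + i - (S.card - 1) = i + 1 by omega]
    exact h0.symm

theorem IsSpanningPath.not_adj_ends (hf : IsSpanningPath G S f) (hS : 3 ≤ S.card)
    (hG : ¬ HasSpanningCycle G S) : ¬ G.Adj (f 0) (f (S.card - 1)) := fun h =>
  hG ⟨hS, f, hf, h.symm⟩

theorem IsSpanningPath.degOn_first [DecidableRel G.Adj] (hf : IsSpanningPath G S f) :
    degOn G S (f 0) =
      ((Finset.range (S.card - 1)).filter fun i => G.Adj (f 0) (f (i + 1))).card := by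
  classical
  unfold degOn
  symm
  refine Finset.card_bij (fun i _ => f (i + 1)) ?_ ?_ ?_
  · intro i hi
    simp only [Finset.mem_filter, Finset.mem_range] at hi ⊢
    exact ⟨hf.mem _ (by omega), hi.2⟩
  · intro i hi j hj h
    simp only [Finset.mem_filter, Finset.mem_range] at hi hj
    have := hf.inj _ (by omega) _ (by omega) h
    omega
  · intro v hv
    simp only [Finset.mem_filter] at hv
    obtain ⟨i, hi, rfl⟩ := hf.surj hv.1
    rcases i with _ | i
    · exact (G.irrefl hv.2).elim
    · exact ⟨i, by simp only [Finset.mem_filter, Finset.mem_range]; exact ⟨by omega, hv.2⟩, rfl⟩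

theorem IsSpanningPath.degOn_last [DecidableRel G.Adj] (hf : IsSpanningPath G S f) :
    degOn G S (f (S.card - 1)) =
      ((Finset.range (S.card - 1)).filter fun i => G.Adj (f (S.card - 1)) (f i)).card := by
  classical
  unfold degOn
  symm
  refine Finset.card_bij (fun i _ => f i) ?_ ?_ ?_
  · intro i hi
    simp only [Finset.mem_filter, Finset.mem_range] at hi ⊢
    exact ⟨hf.mem _ (by omega), hi.2⟩
  · intro i hi j hj h
    simp only [Finset.mem_filter, Finset.mem_range] at hi hj
    exact hf.inj _ (by omega) _ (by omega) h
  · intro v hv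
    simp only [Finset.mem_filter] at hv
    obtain ⟨i, hi, rfl⟩ := hf.surj hv.1
    refine ⟨i, ?_, rfl⟩
    simp only [Finset.mem_filter, Finset.mem_range]
    refine ⟨?_, hv.2⟩
    by_contra h
    rw [show i = S.card - 1 by omega] at hv
    exact G.irrefl hv.2

/-- If `S` has no spanning cycle, the neighbours of the last vertex and the predecessors of the
neighbours of the first vertex of a spanning path are disjoint sets of indices. -/
theorem IsSpanningPath.degOn_add_degOn_le (hf : IsSpanningPath G S f) (hS : 3 ≤ S.card)
    (hG : ¬ HasSpanningCycle G S) :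
    degOn G S (f 0) + degOn G S (f (S.card - 1)) ≤ S.card - 1 := by
  classical
  rw [hf.degOn_first, hf.degOn_last, ← Finset.card_union_of_disjoint]
  · conv_rhs => rw [← Finset.card_range (S.card - 1)]
    exact Finset.card_le_card
      (Finset.union_subset (Finset.filter_subset _ _) (Finset.filter_subset _ _))
  · rw [Finset.disjoint_filter]
    intro i hi h0 h1
    exact hG (hf.hasSpanningCycle_of_crossing hS (by have := Finset.mem_range.1 hi; omega) h0 h1)

/-- In the case of equality in `IsSpanningPath.degOn_add_degOn_le` the two sets of indices
exhaust all of them. -/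
theorem IsSpanningPath.adj_or_adj (hf : IsSpanningPath G S f) (hS : 3 ≤ S.card)
    (hG : ¬ HasSpanningCycle G S)
    (hd : S.card - 1 ≤ degOn G S (f 0) + degOn G S (f (S.card - 1))) {i : ℕ}
    (hi : i + 1 < S.card) : G.Adj (f 0) (f (i + 1)) ∨ G.Adj (f (S.card - 1)) (f i) := by
  classical
  rw [hf.degOn_first, hf.degOn_last, ← Finset.card_union_of_disjoint] at hd
  · have h := Finset.eq_of_subset_of_card_le
      (Finset.union_subset (Finset.filter_subset (fun i => G.Adj (f 0) (f (i + 1)))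
        (Finset.range (S.card - 1))) (Finset.filter_subset
        (fun i => G.Adj (f (S.card - 1)) (f i)) _)) (by rw [Finset.card_range]; exact hd)
    have hi' : i ∈ Finset.range (S.card - 1) := Finset.mem_range.2 (by omega)
    rw [← h] at hi'
    simp only [Finset.mem_union, Finset.mem_filter] at hi'
    tauto
  · rw [Finset.disjoint_filter]
    intro i hi h0 h1
    exact hG (hf.hasSpanningCycle_of_crossing hS (by have := Finset.mem_range.1 hi; omega) h0 h1)

theorem HasSpanningCycle.mono {H : SimpleGraph V} (h : G ≤ H) (hG : HasSpanningCycle G S) :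
    HasSpanningCycle H S := by
  obtain ⟨hS, f, hf, hc⟩ := hG
  exact ⟨hS, f, ⟨hf.mem, hf.inj, fun i hi => h (hf.adj i hi)⟩, h hc⟩

/-! ### Closure under edges of large degree sum, and Ore's theorem -/

/-- The closure lemma of Bondy and Chvátal for the subgraph induced by `S`: a spanning cycle that
uses the new edge opens to a spanning path of `G`, which closes again by the crossing argument. -/
theorem hasSpanningCycle_of_sup_edge {u v : V}
    (hd : u ∈ S → v ∈ S → S.card ≤ degOn G S u + degOn G S v)
    (h : HasSpanningCycle (G ⊔ SimpleGraph.edge u v) S) : HasSpanningCycle G S := by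
  obtain ⟨hS, f, hf, hc⟩ := h
  have key : ∀ {a b : V}, (G ⊔ SimpleGraph.edge u v).Adj a b → ¬ G.Adj a b →
      (a = u ∧ b = v) ∨ (a = v ∧ b = u) := by
    intro a b hab hn
    rcases hab with hab | hab
    · exact (hn hab).elim
    · exact ((SimpleGraph.edge_adj ..).1 hab).1
  by_cases hall : ∃ r < S.card,
      ¬ G.Adj (f (shift S.card r (S.card - 1))) (f (shift S.card r 0))
  · obtain ⟨r, hr, hn⟩ := hall
    obtain ⟨hg, hgc⟩ := hf.rotate hc hr
    set g : ℕ → V := fun i => f (shift S.card r i) with hgdef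
    change (G ⊔ SimpleGraph.edge u v).Adj (g (S.card - 1)) (g 0) at hgc
    change ¬ G.Adj (g (S.card - 1)) (g 0) at hn
    have hends := key hgc hn
    have hg' : IsSpanningPath G S g := by
      refine ⟨hg.mem, hg.inj, fun i hi => ?_⟩
      by_contra hni
      have h2 := key (hg.adj i hi) hni
      have hinj := hg.inj
      -- The edge `uv` joins the ends of `g`, which are not consecutive on `g`.
      have h3 : (g i = g 0 ∧ g (i + 1) = g (S.card - 1)) ∨
          (g i = g (S.card - 1) ∧ g (i + 1) = g 0) := by
        rcases hends with ⟨e1, e2⟩ | ⟨e1, e2⟩ <;> rcases h2 with ⟨e3, e4⟩ | ⟨e3, e4⟩ <;>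
          simp [e1, e2, e3, e4]
      rcases h3 with ⟨e1, e2⟩ | ⟨e1, e2⟩
      · have := hinj _ (by omega) _ (by omega) e1
        have := hinj _ (by omega) _ (by omega) e2
        omega
      · have := hinj _ (by omega) _ (by omega) e2
        omega
    by_contra hG
    have hle := hg'.degOn_add_degOn_le hS hG
    have m1 := hg.mem 0 (by omega)
    have m2 := hg.mem (S.card - 1) (by omega)
    rcases hends with ⟨e1, e2⟩ | ⟨e1, e2⟩ <;> rw [e1, e2] at hle <;> rw [e1] at m2 <;>
      rw [e2] at m1
    · have := hd m2 m1; omega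
    · have := hd m1 m2; omega
  · push Not at hall
    refine ⟨hS, f, ⟨hf.mem, hf.inj, fun i hi => ?_⟩, ?_⟩
    · have := hall (i + 1) hi
      unfold shift at this
      rw [if_neg (by omega), if_pos (by omega)] at this
      convert this using 2 <;> omega
    · have := hall 0 (by omega)
      unfold shift at this
      rw [if_pos (by omega), if_pos (by omega)] at this
      exact this

theorem degOn_mono {H : SimpleGraph V} (h : G ≤ H) (v : V) : degOn G S v ≤ degOn H S v := by
  classical
  unfold degOn
  refine Finset.card_le_card fun w hw => ?_
  simp only [Finset.mem_filter] at hw ⊢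
  exact ⟨hw.1, h hw.2⟩

theorem hasSpanningCycle_of_complete (hS : 3 ≤ S.card)
    (h : ∀ u ∈ S, ∀ v ∈ S, u ≠ v → G.Adj u v) : HasSpanningCycle G S := by
  obtain ⟨d, -⟩ := Finset.card_pos.1 (show 0 < S.card by omega)
  have hg : ∀ i (hi : i < S.card), S.toList[i]?.getD d ∈ S ∧
      S.toList[i]?.getD d = S.toList[i]'(by simpa using hi) := by
    intro i hi
    have hi' : i < S.toList.length := by simpa using hi
    rw [List.getElem?_eq_getElem hi', Option.getD_some]
    exact ⟨Finset.mem_toList.1 (List.getElem_mem hi'), rfl⟩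
  have hinj : ∀ i < S.card, ∀ j < S.card,
      S.toList[i]?.getD d = S.toList[j]?.getD d → i = j := by
    intro i hi j hj hij
    rw [(hg i hi).2, (hg j hj).2] at hij
    exact (S.nodup_toList.getElem_inj_iff).1 hij
  refine ⟨hS, fun i => S.toList[i]?.getD d, ⟨fun i hi => (hg i hi).1, hinj, fun i hi => ?_⟩, ?_⟩
  · refine h _ (hg i (by omega)).1 _ (hg _ hi).1 fun he => ?_
    have := hinj _ (by omega) _ hi he
    omega
  · refine h _ (hg _ (by omega)).1 _ (hg _ (by omega)).1 fun he => ?_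
    have := hinj _ (by omega) _ (by omega) he
    omega

/-- Ore's theorem for the subgraph induced by `S`. -/
theorem hasSpanningCycle_of_ore [Finite V] (hS : 3 ≤ S.card)
    (hd : ∀ u ∈ S, ∀ v ∈ S, u ≠ v → ¬ G.Adj u v → S.card ≤ degOn G S u + degOn G S v) :
    HasSpanningCycle G S := by
  induction G using (Finite.wellFounded_of_trans_of_irrefl
    (fun G H : SimpleGraph V => H < G)).induction with
  | _ G ih =>
    by_cases hG : ∃ u ∈ S, ∃ v ∈ S, u ≠ v ∧ ¬ G.Adj u v
    · obtain ⟨u, hu, v, hv, hne, hna⟩ := hG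
      refine hasSpanningCycle_of_sup_edge (fun _ _ => hd u hu v hv hne hna) (ih _ ?_ ?_)
      · refine lt_of_le_of_ne le_sup_left fun he => hna ?_
        rw [he]
        exact Or.inr (by simp [SimpleGraph.edge_adj, hne])
      · intro a ha b hb hab hn
        exact (hd a ha b hb hab fun h => hn (Or.inl h)).trans
          (add_le_add (degOn_mono le_sup_left a) (degOn_mono le_sup_left b))
    · push Not at hG
      exact hasSpanningCycle_of_complete hS fun u hu v hv hne => hG u hu v hv hne

section Degrees

variable [Fintype V]

theorem degOn_univ (G : SimpleGraph V) (v : V) : degOn G Finset.univ v = deg G v := by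
  classical
  unfold degOn deg
  rw [← Set.ncard_coe_finset]
  congr 1
  ext w
  simp

theorem deg_le_degOn_add_card_sdiff [DecidableEq V] (G : SimpleGraph V) (S : Finset V) (v : V) :
    deg G v ≤ degOn G S v + degOn G (Finset.univ \ S) v := by
  classical
  rw [← degOn_univ]
  unfold degOn
  rw [← Finset.card_union_of_disjoint]
  · refine Finset.card_le_card fun w hw => ?_
    simp only [Finset.mem_union, Finset.mem_filter, Finset.mem_sdiff, Finset.mem_univ] at hw ⊢
    tauto
  · exact Finset.disjoint_filter_filter Finset.disjoint_sdiff

theorem degOn_erase_of_adj [DecidableEq V] {v w : V} (h : G.Adj v w) :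
    degOn G (Finset.univ.erase w) v + 1 = deg G v := by
  classical
  rw [← degOn_univ]
  unfold degOn
  rw [Finset.filter_erase, Finset.card_erase_add_one (by simpa using h)]

theorem degOn_erase_of_not_adj [DecidableEq V] {v w : V} (h : ¬ G.Adj v w) :
    degOn G (Finset.univ.erase w) v = deg G v := by
  classical
  rw [← degOn_univ]
  unfold degOn
  rw [Finset.filter_erase, Finset.erase_eq_of_notMem (by simpa using h)]

theorem deg_le_degOn_erase_add_one [DecidableEq V] (G : SimpleGraph V) (v w : V) :
    deg G v ≤ degOn G (Finset.univ.erase w) v + 1 := by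
  by_cases h : G.Adj v w
  · exact (degOn_erase_of_adj h).ge
  · rw [degOn_erase_of_not_adj h]; omega

theorem card_univ_erase [DecidableEq V] (w : V) :
    (Finset.univ.erase w).card = Fintype.card V - 1 := by
  rw [Finset.card_erase_of_mem (Finset.mem_univ w), Finset.card_univ]

theorem IsOTG.hasSpanningCycle (hG : IsOTG G) (hn : 3 ≤ Fintype.card V) :
    HasSpanningCycle G Finset.univ := by
  refine hasSpanningCycle_of_ore (by simpa using hn) fun u _ v _ hne hna => ?_
  rw [degOn_univ, degOn_univ, Finset.card_univ]
  exact hG u v hne hna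

/-! ### The weak closure -/

theorem IsWeakClosure.le {H : SimpleGraph V} (h : IsWeakClosure G H) : G ≤ H :=
  h.le_of_reach .refl

/-- Joining two nonadjacent vertices of degree sum at least `n + 1` does not affect which vertices
can be deleted without destroying Hamiltonicity. -/
theorem IsWeakClosure.hasSpanningCycle_erase [DecidableEq V] {H : SimpleGraph V}
    (h : IsWeakClosure G H) {w : V} (hH : HasSpanningCycle H (Finset.univ.erase w)) :
    HasSpanningCycle G (Finset.univ.erase w) := by
  have h1 := h.1
  clear h
  induction h1 with
  | refl => exact hH
  | @tail K _ _ hs ih =>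
    refine ih ?_
    obtain ⟨u, v, ⟨hne, hna, hd⟩, rfl⟩ := hs
    refine hasSpanningCycle_of_sup_edge (fun _ _ => ?_) hH
    rw [card_univ_erase]
    have h1 := deg_le_degOn_erase_add_one K u w
    have h2 := deg_le_degOn_erase_add_one K v w
    omega

/-- In the weak closure of a graph satisfying Ore's condition, nonadjacent vertices have degree sum
exactly `n`. -/
theorem IsWeakClosure.deg_add_deg {H : SimpleGraph V} (h : IsWeakClosure G H) (hG : IsOTG G)
    {u v : V} (hne : u ≠ v) (hna : ¬ H.Adj u v) : deg H u + deg H v = Fintype.card V := by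
  have h1 := hG u v hne fun ha => hna (h.le ha)
  have h2 := deg_mono h.le u
  have h3 := deg_mono h.le v
  have h4 : ¬ (Fintype.card V + 1 ≤ deg H u + deg H v) := fun hd => h.2 u v ⟨hne, hna, hd⟩
  omega

end Degrees

end HForce

namespace HForce

/-! ### Vertices whose deletion destroys Hamiltonicity -/

/-- Deleting `x` and `y` disconnects `G`: the nonempty set `A` is a union of components of
`G - x - y`, and there are further vertices besides `A`, `x` and `y`. -/
structure IsSeparatingPair {V : Type*} (G : SimpleGraph V) (x y : V) (A : Finset V) : Prop where
  ne : x ≠ y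
  nonempty : A.Nonempty
  left_notMem : x ∉ A
  right_notMem : y ∉ A
  exists_notMem : ∃ b ∉ A, b ≠ x ∧ b ≠ y
  not_adj : ∀ a ∈ A, ∀ b ∉ A, b ≠ x → b ≠ y → ¬ G.Adj a b

variable {V : Type*} [Fintype V] [DecidableEq V] {H : SimpleGraph V}

omit [Fintype V] [DecidableEq V] in
theorem IsSpanningPath.ne_ends {S : Finset V} {f : ℕ → V} (hf : IsSpanningPath H S f)
    (hS : 3 ≤ S.card) : f 0 ≠ f (S.card - 1) := fun h => by
  have := hf.inj 0 (by omega) _ (by omega) h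
  omega

/-- If `H - v` is not Hamiltonian, then the ends of every Hamiltonian path of `H - v` lose a
neighbour by the deletion of `v`. -/
theorem IsSpanningPath.adj_deleted
    (hH : ∀ u w, u ≠ w → ¬ H.Adj u w → deg H u + deg H w = Fintype.card V)
    (hn : 5 ≤ Fintype.card V) {v : V} (hv : ¬ HasSpanningCycle H (Finset.univ.erase v))
    {f : ℕ → V} (hf : IsSpanningPath H (Finset.univ.erase v) f) :
    H.Adj (f 0) v ∧ H.Adj (f ((Finset.univ.erase v).card - 1)) v ∧
      (Finset.univ.erase v).card - 1 ≤ degOn H (Finset.univ.erase v) (f 0) +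
        degOn H (Finset.univ.erase v) (f ((Finset.univ.erase v).card - 1)) := by
  have hc := card_univ_erase v
  have hS : 3 ≤ (Finset.univ.erase v).card := by omega
  have h1 := hH _ _ (hf.ne_ends hS) (hf.not_adj_ends hS hv)
  have h2 := hf.degOn_add_degOn_le hS hv
  have h3 := deg_le_degOn_erase_add_one H (f 0) v
  have h4 := deg_le_degOn_erase_add_one H (f ((Finset.univ.erase v).card - 1)) v
  refine ⟨?_, ?_, by omega⟩
  · by_contra hna
    have := degOn_erase_of_not_adj hna
    omega
  · by_contra hna
    have := degOn_erase_of_not_adj hna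
    omega

/-- If `H - v` is not Hamiltonian but has a cycle through all its vertices except `z`, then either
`z` has only one neighbour on the cycle, or `z` and the successors of its neighbours on the cycle
form an independent set of `n / 2` vertices. Here `z` is the last vertex of the spanning path `g`,
and the other vertices of `g` form the cycle. -/
theorem IsSpanningPath.separatingPair_or_indepSet
    (hH : ∀ u w, u ≠ w → ¬ H.Adj u w → deg H u + deg H w = Fintype.card V)
    (hn : 5 ≤ Fintype.card V) {v : V} (hv : ¬ HasSpanningCycle H (Finset.univ.erase v))
    {g : ℕ → V} {M : ℕ} (hM : (Finset.univ.erase v).card = M + 1)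
    (hg : IsSpanningPath H (Finset.univ.erase v) g) (hc : H.Adj (g (M - 1)) (g 0)) :
    (∃ y A, IsSeparatingPair H v y A) ∨
      ∃ I : Finset V, H.IsIndepSet I ∧ 2 * I.card = Fintype.card V ∧ v ∉ I := by
  classical
  have hcard := card_univ_erase v
  have hS : 3 ≤ (Finset.univ.erase v).card := by omega
  set z := g M with hz
  -- The successor of an index on the cycle `g 0, …, g (M - 1)`.
  let next : ℕ → ℕ := fun j => if j + 1 < M then j + 1 else 0
  have next_lt : ∀ j, next j < M := by intro j; simp only [next]; split_ifs <;> omega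
  have next_inj : ∀ i < M, ∀ j < M, next i = next j → i = j := by
    intro i hi j hj h; simp only [next] at h; split_ifs at h <;> omega
  -- The cycle, opened behind a neighbour `g j` of `z` and prolonged to `z`.
  have hpath : ∀ j < M, H.Adj z (g j) → IsSpanningPath H (Finset.univ.erase v)
      (fun t => g (if t < M then shift M (next j) t else M)) := by
    intro j hj hzj
    refine hg.reindex _ ?_ ?_ ?_
    · intro t ht; simp only [next, shift]; split_ifs <;> omega
    · intro s hs t ht; simp only [next, shift]; split_ifs <;> omega
    · intro t ht
      by_cases h1 : t + 1 < M
      · by_cases h2 : t + next j = M - 1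
        · rw [if_pos (by omega), if_pos h1]
          have e1 : shift M (next j) t = M - 1 := by simp only [shift]; split_ifs <;> omega
          have e2 : shift M (next j) (t + 1) = 0 := by simp only [shift]; split_ifs <;> omega
          rw [e1, e2]
          exact hc
        · refine hg.adj' ?_ ?_ ?_ <;> simp only [next, shift] at h2 ⊢ <;> split_ifs at h2 ⊢ <;> omega
      · rw [if_pos (by omega), if_neg h1]
        have e1 : shift M (next j) t = j := by simp only [next, shift]; split_ifs <;> omega
        rw [e1]
        exact hzj.symm
  have hp0 : ∀ j, (if 0 < M then shift M (next j) 0 else M) = next j := by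
    intro j
    have := next_lt j
    rw [if_pos (by omega), shift, if_pos (by omega), Nat.zero_add]
  have hpM : ∀ j, (if (Finset.univ.erase v).card - 1 < M then
      shift M (next j) ((Finset.univ.erase v).card - 1) else M) = M := by
    intro j; rw [if_neg (by omega)]
  have hend : ∀ j < M, H.Adj z (g j) →
      ¬ H.Adj (g (next j)) z ∧ H.Adj (g (next j)) v ∧ H.Adj z v := by
    intro j hj hzj
    have h1 := (hpath j hj hzj).not_adj_ends hS hv
    have h2 := (hpath j hj hzj).adj_deleted hH hn hv
    simp only [hp0, hpM] at h1 h2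
    exact ⟨h1, h2.1, h2.2.1⟩
  have hindep : ∀ j < M, H.Adj z (g j) → ∀ i < M, H.Adj z (g i) →
      ¬ H.Adj (g (next j)) (g (next i)) := by
    intro j hj hzj i hi hzi hadj
    by_cases hij : i = j
    · subst hij; exact H.irrefl hadj
    -- `t` is the position of `g i` on the path that starts at the successor of `g j`.
    have ht : ∃ t, t + 1 < M ∧ shift M (next j) t = i ∧ shift M (next j) (t + 1) = next i := by
      rcases Nat.lt_or_gt_of_ne hij with h | h
      · refine ⟨i + M - (j + 1), by omega, ?_, ?_⟩ <;>
          simp only [next, shift] <;> split_ifs <;> omega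
      · refine ⟨i - (j + 1), by omega, ?_, ?_⟩ <;>
          simp only [next, shift] <;> split_ifs <;> omega
    obtain ⟨t, ht, e1, e2⟩ := ht
    refine hv ((hpath j hj hzj).hasSpanningCycle_of_crossing hS (i := t) (by omega) ?_ ?_)
    · simp only [hp0, if_pos ht, e2]; exact hadj
    · simp only [hpM, if_pos (show t < M by omega), e1]; exact hzi
  set N := (Finset.range M).filter (fun i => H.Adj z (g i)) with hN
  have memN : ∀ {i}, i ∈ N ↔ i < M ∧ H.Adj z (g i) := by intro i; simp [hN]
  have hlast : M - 1 ∈ N := memN.2 ⟨by omega, by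
    have := hg.adj (M - 1) (by omega)
    rw [show M - 1 + 1 = M by omega] at this
    exact this.symm⟩
  have hzv := (hend _ (memN.1 hlast).1 (memN.1 hlast).2).2.2
  have hdz : deg H z = N.card + 1 := by
    rw [← degOn_erase_of_adj hzv]
    have := hg.degOn_last
    rw [hM, Nat.add_sub_cancel] at this
    rw [this]
  by_cases hN1 : N.card = 1
  · left
    obtain ⟨a, ha⟩ := Finset.card_eq_one.1 hN1
    have hone : ∀ i ∈ N, i = M - 1 := by
      intro i hi
      rw [ha] at hi hlast
      rw [Finset.mem_singleton.1 hi, Finset.mem_singleton.1 hlast]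
    have hmem : ∀ i ≤ M, g i ≠ v := fun i hi => Finset.ne_of_mem_erase (hg.mem i (by omega))
    have hne : ∀ i ≤ M, ∀ j ≤ M, i ≠ j → g i ≠ g j := fun i hi j hj hij h =>
      hij (hg.inj i (by omega) j (by omega) h)
    refine ⟨g (M - 1), {z}, (hmem _ (by omega)).symm, Finset.singleton_nonempty z, ?_, ?_,
      ⟨g 0, ?_, hmem 0 (by omega), hne _ (by omega) _ (by omega) (by omega)⟩, ?_⟩
    · simpa using (hmem M le_rfl).symm
    · simpa using hne (M - 1) (by omega) M le_rfl (by omega)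
    · simpa using hne 0 (by omega) M le_rfl (by omega)
    · intro a' ha' b hb hbv hby hadj
      rw [Finset.mem_singleton] at ha' hb
      subst ha'
      obtain ⟨i, hi, rfl⟩ := hg.surj (Finset.mem_erase.2 ⟨hbv, Finset.mem_univ b⟩)
      have hiM : i ≠ M := fun h => hb (by rw [h])
      exact hby (by rw [hone i (memN.2 ⟨by omega, hadj⟩)])
  · right
    have hinj : Set.InjOn (fun i => g (next i)) N := by
      intro i hi j hj hij
      have h1 := next_lt i
      have h2 := next_lt j
      exact next_inj i (memN.1 hi).1 j (memN.1 hj).1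
        (hg.inj _ (by omega) _ (by omega) hij)
    have hznot : z ∉ N.image (fun i => g (next i)) := by
      intro h
      obtain ⟨i, -, hi⟩ := Finset.mem_image.1 h
      have h1 := next_lt i
      have := hg.inj _ (by omega) _ (by omega) hi
      omega
    have hdeg : ∀ i ∈ N, deg H (g (next i)) + deg H z = Fintype.card V := by
      intro i hi
      refine hH _ _ (fun h => hznot ?_) (hend i (memN.1 hi).1 (memN.1 hi).2).1
      rw [← h]
      exact Finset.mem_image_of_mem _ hi
    refine ⟨insert z (N.image fun i => g (next i)), ?_, ?_, ?_⟩
    · intro a ha b hb _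
      simp only [Finset.coe_insert, Finset.coe_image, Set.mem_insert_iff, Set.mem_image,
        Finset.mem_coe] at ha hb
      rcases ha with rfl | ⟨i, hi, rfl⟩ <;> rcases hb with rfl | ⟨j, hj, rfl⟩
      · exact H.irrefl
      · exact fun h => (hend j (memN.1 hj).1 (memN.1 hj).2).1 h.symm
      · exact (hend i (memN.1 hi).1 (memN.1 hi).2).1
      · exact hindep i (memN.1 hi).1 (memN.1 hi).2 j (memN.1 hj).1 (memN.1 hj).2
    · rw [Finset.card_insert_of_notMem hznot, Finset.card_image_of_injOn hinj]
      have hpos : 0 < N.card := Finset.card_pos.2 ⟨_, hlast⟩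
      -- Two successors have the same degree `n - deg z`, so their degree sum `n` is twice that.
      obtain ⟨i, hi, j, hj, hij⟩ := Finset.one_lt_card.1 (show 1 < N.card by omega)
      have h1 := hdeg i hi
      have h2 := hdeg j hj
      have h3 := hH (g (next i)) (g (next j)) (fun h => hij (hinj hi hj h))
        (hindep i (memN.1 hi).1 (memN.1 hi).2 j (memN.1 hj).1 (memN.1 hj).2)
      omega
    · intro h
      rcases Finset.mem_insert.1 h with h | h
      · exact H.irrefl (h ▸ hzv)
      · obtain ⟨i, hi, h⟩ := Finset.mem_image.1 h
        exact H.irrefl (h ▸ (hend i (memN.1 hi).1 (memN.1 hi).2).2.1)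

/-- The extremal alternative: if nonadjacent vertices of the Hamiltonian graph `H` have degree sum
`n` and `H - v` is not Hamiltonian, then `v` belongs to a separating pair, or some `n / 2` vertices
other than `v` are independent. -/
theorem separatingPair_or_indepSet
    (hH : ∀ u w, u ≠ w → ¬ H.Adj u w → deg H u + deg H w = Fintype.card V)
    (hn : 5 ≤ Fintype.card V) (hham : HasSpanningCycle H Finset.univ) {v : V}
    (hv : ¬ HasSpanningCycle H (Finset.univ.erase v)) :
    (∃ y A, IsSeparatingPair H v y A) ∨
      ∃ I : Finset V, H.IsIndepSet I ∧ 2 * I.card = Fintype.card V ∧ v ∉ I := by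
  classical
  have hcard := card_univ_erase v
  have hS : 3 ≤ (Finset.univ.erase v).card := by omega
  obtain ⟨f, hf⟩ : ∃ f, IsSpanningPath H (Finset.univ.erase v) f := by
    obtain ⟨-, f, hf, hc⟩ := hham
    obtain ⟨r, hr, hrv⟩ := hf.surj (Finset.mem_univ v)
    obtain ⟨hg, -⟩ := hf.rotate hc hr
    have h0 : f (shift (Finset.univ : Finset V).card r 0) = v := by
      rw [shift, if_pos (by omega), Nat.zero_add, hrv]
    have hu : (Finset.univ : Finset V).card = Fintype.card V := Finset.card_univ
    refine ⟨fun i => f (shift (Finset.univ : Finset V).card r (i + 1)), fun i hi => ?_,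
      fun i hi j hj h => ?_, fun i hi => hg.adj (i + 1) (by omega)⟩
    · refine Finset.mem_erase.2 ⟨fun h => ?_, Finset.mem_univ _⟩
      have := hg.inj (i + 1) (by omega) 0 (by omega) (h.trans h0.symm)
      omega
    · have := hg.inj (i + 1) (by omega) (j + 1) (by omega) h
      omega
  obtain ⟨m, hm⟩ : ∃ m, (Finset.univ.erase v).card = m := ⟨_, rfl⟩
  have hd := (hf.adj_deleted hH hn hv).2.2
  have hends := hf.not_adj_ends hS hv
  have hor : ∀ i, i + 1 < m → H.Adj (f 0) (f (i + 1)) ∨ H.Adj (f (m - 1)) (f i) := by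
    intro i hi
    have := hf.adj_or_adj hS hv hd (i := i) (by omega)
    rwa [hm] at this
  rw [hm] at hends hS
  by_cases hanti : ∀ i, i + 2 < m → H.Adj (f 0) (f (i + 2)) → H.Adj (f 0) (f (i + 1))
  · -- The neighbours of `f 0` are an initial segment `f 1, …, f s` of the path, and those of
    -- the last vertex are the final segment that starts at `f s`.
    left
    have hex : ∃ s, s + 1 < m ∧ ¬ H.Adj (f 0) (f (s + 1)) :=
      ⟨m - 2, by omega, by rwa [show m - 2 + 1 = m - 1 by omega]⟩
    let s := Nat.find hex
    obtain ⟨hs1, hs2⟩ : s + 1 < m ∧ ¬ H.Adj (f 0) (f (s + 1)) := Nat.find_spec hex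
    have hlow : ∀ i < s, H.Adj (f 0) (f (i + 1)) := by
      intro i hi
      have := Nat.find_min hex hi
      by_contra h
      exact this ⟨by omega, h⟩
    have hhigh : ∀ i, s ≤ i → i + 1 < m → H.Adj (f (m - 1)) (f i) := by
      intro i hi him
      refine (hor i him).resolve_left ?_
      induction i, hi using Nat.le_induction with
      | base => exact hs2
      | succ i hi ih => exact fun h => ih (by omega) (hanti i (by omega) h)
    have hs0 : 0 < s := by
      refine Nat.pos_of_ne_zero fun h => hs2 ?_
      rw [h]
      exact hf.adj 0 (by omega)
    have hna : ∀ i < s, ∀ j, s < j → j < m → ¬ H.Adj (f i) (f j) := by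
      intro i hi j hj hjm
      -- Reversing the segments up to `f i` and from `f j` on gives a path from `f i` to `f j`.
      have hp : IsSpanningPath H (Finset.univ.erase v)
          (fun t => f (if t ≤ i then i - t else if t < j then t else m - 1 + j - t)) := by
        refine hf.reindex _ ?_ ?_ ?_
        · intro t ht; split_ifs <;> omega
        · intro a ha t ht; split_ifs <;> omega
        · intro t ht
          by_cases h1 : t = i
          · subst h1
            rw [if_pos le_rfl, if_neg (by omega), if_pos (by omega), Nat.sub_self]
            exact hlow t hi
          · by_cases h2 : t + 1 = j
            · rw [if_neg (by omega), if_pos (by omega), if_neg (by omega), if_neg (by omega),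
                show m - 1 + j - (t + 1) = m - 1 by omega]
              exact (hhigh t (by omega) (by omega)).symm
            · refine hf.adj' ?_ ?_ ?_ <;> split_ifs <;> omega
      have := hp.not_adj_ends (by omega) hv
      simp only [hm, zero_le, if_true, show ¬ m - 1 ≤ i by omega, show ¬ m - 1 < j by omega,
        if_false, Nat.sub_zero, show m - 1 + j - (m - 1) = j by omega] at this
      exact this
    have hmem : ∀ i < m, f i ≠ v := fun i hi => Finset.ne_of_mem_erase (hf.mem i (by omega))
    have hnotMem : ∀ j, s ≤ j → j < m → f j ∉ (Finset.range s).image f := by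
      intro j hj hjm h
      obtain ⟨i, hi, he⟩ := Finset.mem_image.1 h
      rw [Finset.mem_range] at hi
      have := hf.inj i (by omega) j (by omega) he
      omega
    refine ⟨f s, (Finset.range s).image f, (hmem s (by omega)).symm,
      ⟨f 0, Finset.mem_image_of_mem f (Finset.mem_range.2 hs0)⟩, ?_, hnotMem s le_rfl (by omega),
      ⟨f (m - 1), hnotMem _ (by omega) (by omega), hmem _ (by omega), ?_⟩, ?_⟩
    · intro h
      obtain ⟨i, hi, he⟩ := Finset.mem_image.1 h
      rw [Finset.mem_range] at hi
      exact hmem i (by omega) he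
    · intro h
      have := hf.inj _ (by omega) _ (by omega) h
      omega
    · intro a ha b hb hbv hbs
      obtain ⟨i, hi, rfl⟩ := Finset.mem_image.1 ha
      rw [Finset.mem_range] at hi
      obtain ⟨j, hj, rfl⟩ := hf.surj (Finset.mem_erase.2 ⟨hbv, Finset.mem_univ b⟩)
      refine hna i hi j ?_ (by omega)
      by_contra h
      rcases Nat.lt_or_ge j s with h1 | h1
      · exact hb (Finset.mem_image_of_mem f (Finset.mem_range.2 h1))
      · exact hbs (by rw [show j = s by omega])
  · -- Both `f 0 ~ f (i + 2)` and `f (m - 1) ~ f i`: a cycle that misses only `f (i + 1)`.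
    push Not at hanti
    obtain ⟨i, hi, h1, h2⟩ := hanti
    have h3 := (hor i (by omega)).resolve_left h2
    have hp : IsSpanningPath H (Finset.univ.erase v)
        (fun t => f (if t ≤ i then t else if t = m - 1 then i + 1 else m + i - t)) := by
      refine hf.reindex _ ?_ ?_ ?_
      · intro t ht; split_ifs <;> omega
      · intro a ha t ht; split_ifs <;> omega
      · intro t ht
        by_cases h4 : t = i
        · subst h4
          rw [if_pos le_rfl, if_neg (by omega), if_neg (by omega),
            show m + t - (t + 1) = m - 1 by omega]
          exact h3.symm
        · refine hf.adj' ?_ ?_ ?_ <;> split_ifs <;> omega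
    refine hp.separatingPair_or_indepSet hH hn hv (M := m - 1) (by omega) ?_
    simp only [zero_le, if_true, show ¬ m - 1 - 1 ≤ i by omega, if_false,
      show ¬ m - 1 - 1 = m - 1 by omega, show m + i - (m - 1 - 1) = i + 2 by omega]
    exact h1.symm

end HForce

namespace HForce

/-! ### Cycles as closed walks -/

section Walks

variable {V : Type*} {G : SimpleGraph V}

theorem IsSpanningPath.exists_walk {S : Finset V} {f : ℕ → V} (hf : IsSpanningPath G S f) {j : ℕ}
    (hj : j < S.card) : ∃ p : G.Walk (f 0) (f j), p.support = (List.range (j + 1)).map f ∧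
      p.edges = (List.range j).map fun i => s(f i, f (i + 1)) := by
  induction j with
  | zero => exact ⟨.nil, by simp, by simp⟩
  | succ j ih =>
    obtain ⟨p, h1, h2⟩ := ih (by omega)
    refine ⟨p.concat (hf.adj j hj), ?_, ?_⟩
    · rw [SimpleGraph.Walk.support_concat, h1, List.range_succ (n := j + 1)]
      simp
    · rw [SimpleGraph.Walk.edges_concat, h2, List.range_succ (n := j)]
      simp

theorem HasSpanningCycle.exists_isCycle {S : Finset V} (h : HasSpanningCycle G S) :
    ∃ (v : V) (c : G.Walk v v), c.IsCycle ∧ (∀ x, x ∈ c.support ↔ x ∈ S) ∧ c.length = S.card := by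
  obtain ⟨hS, f, hf, hc⟩ := h
  obtain ⟨p, h1, h2⟩ := hf.exists_walk (j := S.card - 1) (by omega)
  rw [show S.card - 1 + 1 = S.card by omega] at h1
  have hsupp : ∀ x, x ∈ p.support ↔ x ∈ S := by
    intro x
    rw [h1, List.mem_map]
    constructor
    · rintro ⟨i, hi, rfl⟩
      exact hf.mem i (List.mem_range.1 hi)
    · intro hx
      obtain ⟨i, hi, rfl⟩ := hf.surj hx
      exact ⟨i, List.mem_range.2 hi, rfl⟩
  have hlen : p.length + 1 = S.card := by
    rw [← SimpleGraph.Walk.length_support, h1]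
    simp
  refine ⟨_, .cons hc p, ?_, ?_, ?_⟩
  · rw [SimpleGraph.Walk.cons_isCycle_iff, SimpleGraph.Walk.isPath_def, h1, h2]
    constructor
    · refine List.Nodup.map_on ?_ List.nodup_range
      intro i hi j hj hij
      exact hf.inj i (List.mem_range.1 hi) j (List.mem_range.1 hj) hij
    · intro h
      obtain ⟨i, hi, he⟩ := List.mem_map.1 h
      rw [List.mem_range] at hi
      rcases Sym2.eq_iff.1 he with ⟨e1, e2⟩ | ⟨e1, e2⟩
      · have := hf.inj _ (by omega) _ (by omega) e2
        omega
      · have := hf.inj _ (by omega) _ (by omega) e1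
        have := hf.inj _ (by omega) _ (by omega) e2
        omega
  · intro x
    rw [SimpleGraph.Walk.support_cons, List.mem_cons, hsupp]
    exact or_iff_right_of_imp fun h => h ▸ hf.mem _ (by omega)
  · rw [SimpleGraph.Walk.length_cons, hlen]

theorem exists_getVert_eq_of_mem_support {v : V} {c : G.Walk v v} (hc : c.IsCycle) {x : V}
    (hx : x ∈ c.support) : ∃ i < c.length, c.getVert i = x := by
  obtain ⟨i, rfl, hi⟩ := SimpleGraph.Walk.mem_support_iff_exists_getVert.1 hx
  have := hc.three_le_length
  rcases Nat.lt_or_eq_of_le hi with h | h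
  · exact ⟨i, h, rfl⟩
  · exact ⟨0, by omega, by rw [h, SimpleGraph.Walk.getVert_length, SimpleGraph.Walk.getVert_zero]⟩

/-- On a cycle through the independent set `I`, the vertices of `I` and their predecessors are
different. -/
theorem two_mul_card_le_length [DecidableEq V] {v : V} {c : G.Walk v v} (hc : c.IsCycle)
    {I : Finset V} (hI : G.IsIndepSet I) (hs : ∀ x ∈ I, x ∈ c.support) :
    2 * I.card ≤ c.length := by
  let J := (Finset.range c.length).filter fun i => c.getVert i ∈ I
  let K := (Finset.range c.length).filter fun i => c.getVert (i + 1) ∈ I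
  have hJ : I.card ≤ J.card := by
    refine (Finset.card_le_card fun x hx => ?_).trans (Finset.card_image_le (f := c.getVert))
    obtain ⟨i, hi, rfl⟩ := exists_getVert_eq_of_mem_support hc (hs x hx)
    exact Finset.mem_image_of_mem _ (Finset.mem_filter.2 ⟨Finset.mem_range.2 hi, hx⟩)
  have hK : I.card ≤ K.card := by
    refine (Finset.card_le_card fun x hx => ?_).trans
      (Finset.card_image_le (f := fun i => c.getVert (i + 1)))
    obtain ⟨i, hi, rfl⟩ := exists_getVert_eq_of_mem_support hc (hs x hx)
    rcases i with _ | i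
    · refine Finset.mem_image.2 ⟨c.length - 1, Finset.mem_filter.2 ⟨?_, ?_⟩, ?_⟩
      · exact Finset.mem_range.2 (by omega)
      · rw [show c.length - 1 + 1 = c.length by omega, SimpleGraph.Walk.getVert_length]
        rwa [SimpleGraph.Walk.getVert_zero] at hx
      · rw [show c.length - 1 + 1 = c.length by omega, SimpleGraph.Walk.getVert_length,
          SimpleGraph.Walk.getVert_zero]
    · exact Finset.mem_image.2 ⟨i, Finset.mem_filter.2 ⟨Finset.mem_range.2 (by omega), hx⟩, rfl⟩
  have hd : Disjoint J K := by
    rw [Finset.disjoint_filter]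
    intro i hi h1 h2
    have ha := c.adj_getVert_succ (Finset.mem_range.1 hi)
    exact hI h1 h2 ha.ne ha
  have h := Finset.card_le_card
    (Finset.union_subset (Finset.filter_subset _ _) (Finset.filter_subset _ _) :
      J ∪ K ⊆ Finset.range c.length)
  rw [Finset.card_union_of_disjoint hd, Finset.card_range] at h
  omega

theorem isCycle_length_le [Fintype V] {v : V} {c : G.Walk v v} (hc : c.IsCycle) :
    c.length ≤ Fintype.card V := by
  have h := hc.support_nodup.length_le_card
  rwa [List.length_tail, SimpleGraph.Walk.length_support, Nat.add_sub_cancel] at h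

theorem isHamiltonianCycle_of_forall_mem [Fintype V] [DecidableEq V] {v : V} {c : G.Walk v v}
    (hc : c.IsCycle) (h : ∀ x, x ∈ c.support) : c.IsHamiltonianCycle := by
  rw [SimpleGraph.Walk.isHamiltonianCycle_iff_isCycle_and_length_eq]
  refine ⟨hc, le_antisymm (isCycle_length_le hc) ?_⟩
  rw [← Finset.card_univ, ← Finset.card_range c.length]
  refine (Finset.card_le_card fun x _ => ?_).trans (Finset.card_image_le (f := c.getVert))
  obtain ⟨i, hi, rfl⟩ := exists_getVert_eq_of_mem_support hc (h x)
  exact Finset.mem_image_of_mem _ (Finset.mem_range.2 hi)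

namespace IsSeparatingPair

variable {x y : V} {A : Finset V}

theorem anti {H : SimpleGraph V} (h : IsSeparatingPair H x y A) (hGH : G ≤ H) :
    IsSeparatingPair G x y A :=
  ⟨h.ne, h.nonempty, h.left_notMem, h.right_notMem, h.exists_notMem,
    fun a ha b hb hx hy hab => h.not_adj a ha b hb hx hy (hGH hab)⟩

/-- A walk `q` leaves `A` through `x` or `y`. -/
theorem exists_crossing (h : IsSeparatingPair G x y A) {q : ℕ → V} {k : ℕ}
    (hq : ∀ i < k, G.Adj (q i) (q (i + 1))) (h0 : q 0 ∈ A) (hk : q k ∉ A) (hkx : q k ≠ x)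
    (hky : q k ≠ y) : ∃ t, 0 < t ∧ t < k ∧ (q t = x ∨ q t = y) := by
  classical
  have hex : ∃ t, q t ∉ A := ⟨k, hk⟩
  have h1 := Nat.find_spec hex
  have h2 : Nat.find hex ≤ k := Nat.find_min' hex hk
  obtain ⟨s, hs⟩ : ∃ s, Nat.find hex = s + 1 := by
    refine Nat.exists_eq_succ_of_ne_zero fun h => ?_
    rw [h] at h1
    exact h1 h0
  have h3 : q s ∈ A := by
    have := Nat.find_min hex (m := s) (by omega)
    exact not_not.1 this
  rw [hs] at h1 h2
  have h4 : q (s + 1) = x ∨ q (s + 1) = y := by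
    by_contra hn
    push Not at hn
    exact h.not_adj _ h3 _ h1 hn.1 hn.2 (hq s (by omega))
  refine ⟨s + 1, by omega, lt_of_le_of_ne h2 fun he => ?_, h4⟩
  rw [he] at h4
  exact h4.elim hkx hky

/-- A cycle that meets both sides of a separating pair passes through both of its vertices. -/
theorem mem_support (h : IsSeparatingPair G x y A) {v : V} {c : G.Walk v v} (hc : c.IsCycle)
    {a b : V} (ha : a ∈ A) (hb : b ∉ A) (hbx : b ≠ x) (hby : b ≠ y) (hac : a ∈ c.support)
    (hbc : b ∈ c.support) : x ∈ c.support ∧ y ∈ c.support := by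
  classical
  have hmem : ∀ w, w ∈ (c.rotate a hac).support ↔ w ∈ c.support := fun w =>
    SimpleGraph.Walk.mem_support_rotate_iff ..
  rw [← hmem b] at hbc
  rw [← hmem x, ← hmem y]
  have hd := hc.rotate hac
  set d := c.rotate a hac
  obtain ⟨j, hj, rfl⟩ := exists_getVert_eq_of_mem_support hd hbc
  obtain ⟨s, hs0, hs, hsx⟩ := h.exists_crossing (q := d.getVert) (k := j)
    (fun i hi => d.adj_getVert_succ (by omega)) (by simpa using ha) hb hbx hby
  obtain ⟨t, ht0, ht, htx⟩ := h.exists_crossing (q := fun i => d.getVert (d.length - i))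
    (k := d.length - j) (fun i hi => by
      have := d.adj_getVert_succ (i := d.length - (i + 1)) (by omega)
      rw [show d.length - (i + 1) + 1 = d.length - i by omega] at this
      exact this.symm)
    (by simpa using ha)
    (by rwa [show d.length - (d.length - j) = j by omega])
    (by rwa [show d.length - (d.length - j) = j by omega])
    (by rwa [show d.length - (d.length - j) = j by omega])
  have hne : d.getVert s ≠ d.getVert (d.length - t) := fun he => by
    have := hd.getVert_injOn (x₁ := s) (x₂ := d.length - t) (by constructor <;> omega)
      (by constructor <;> omega) he
    omega
  have m1 := d.getVert_mem_support s
  have m2 := d.getVert_mem_support (d.length - t)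
  rcases hsx with e1 | e1 <;> rcases htx with e2 | e2 <;> rw [e1, e2] at hne <;>
    rw [e1] at m1 <;> rw [e2] at m2
  · exact (hne rfl).elim
  · exact ⟨m1, m2⟩
  · exact ⟨m2, m1⟩
  · exact (hne rfl).elim

end IsSeparatingPair

end Walks

/-! ### Minimum H-force sets -/

variable {V : Type*} [Fintype V] [DecidableEq V] {G H : SimpleGraph V}

theorem IsHForceSet.not_subset {X S : Finset V} (hX : IsHForceSet G X)
    (hS : HasSpanningCycle G S) (hne : S ≠ Finset.univ) : ¬ X ⊆ S := by
  intro hXS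
  obtain ⟨v, c, hc, hs, -⟩ := hS.exists_isCycle
  refine hne (Finset.eq_univ_of_forall fun x => (hs x).1 ?_)
  exact (hX.2 v c hc fun x hx => (hs x).2 (hXS hx)).mem_support x

theorem IsHForceSet.mem {X : Finset V} (hX : IsHForceSet G X) {v : V}
    (h : HasSpanningCycle G (Finset.univ.erase v)) : v ∈ X := by
  by_contra hv
  refine hX.not_subset h (fun he => Finset.notMem_erase v Finset.univ ?_) fun x hx => ?_
  · rw [he]; exact Finset.mem_univ v
  · exact Finset.mem_erase.2 ⟨fun he => hv (he ▸ hx), Finset.mem_univ x⟩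

omit [Fintype V] in
theorem IsMinHForceSet.hForceNumber_eq {X : Finset V} (hX : IsMinHForceSet G X) :
    hForceNumber G = X.card := by
  refine le_antisymm (Nat.sInf_le ⟨X, hX.1, rfl⟩) ?_
  refine le_csInf ⟨_, X, hX.1, rfl⟩ ?_
  rintro k ⟨Y, hY, rfl⟩
  exact hX.2 Y hY

omit [Fintype V] in
theorem isMinHForceSet_iff_eq {T : Finset V} (hT : IsHForceSet G T)
    (h : ∀ X, IsHForceSet G X → T ⊆ X) (X : Finset V) : IsMinHForceSet G X ↔ X = T := by
  constructor
  · intro hX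
    exact (Finset.eq_of_subset_of_card_le (h X hX.1) (hX.2 T hT)).symm
  · rintro rfl
    exact ⟨hT, fun Y hY => Finset.card_le_card (h Y hY)⟩

theorem isHForceSet_univ [Nonempty V] : IsHForceSet G Finset.univ :=
  ⟨Finset.univ_nonempty, fun _ _ hc h =>
    isHamiltonianCycle_of_forall_mem hc fun x => h x (Finset.mem_univ x)⟩

theorem HasSpanningCycle.isHamiltonian (h : HasSpanningCycle G Finset.univ) :
    G.IsHamiltonian := by
  obtain ⟨v, c, hc, hs, -⟩ := h.exists_isCycle
  exact fun _ => ⟨v, c, isHamiltonianCycle_of_forall_mem hc fun x => (hs x).2 (Finset.mem_univ x)⟩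

/-! ### The case of a separating pair -/

theorem deg_eq_card_sub_one_iff (z : V) :
    deg H z = Fintype.card V - 1 ↔ ∀ w, w ≠ z → H.Adj z w := by
  classical
  have hsub : Finset.univ.filter (H.Adj z) ⊆ Finset.univ.erase z := fun w hw =>
    Finset.mem_erase.2 ⟨((Finset.mem_filter.1 hw).2.ne').elim, Finset.mem_univ w⟩
  rw [← degOn_univ, degOn, ← card_univ_erase z]
  constructor
  · intro h w hw
    have := Finset.eq_of_subset_of_card_le hsub h.ge
    have hw' : w ∈ Finset.univ.erase z := Finset.mem_erase.2 ⟨hw, Finset.mem_univ w⟩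
    rw [← this] at hw'
    exact (Finset.mem_filter.1 hw').2
  · intro h
    congr 1
    refine Finset.Subset.antisymm hsub fun w hw => ?_
    exact Finset.mem_filter.2 ⟨Finset.mem_univ w, h w (Finset.ne_of_mem_erase hw)⟩

namespace IsSeparatingPair

variable {x y : V} {A : Finset V}

/-- The other side of a separating pair. -/
theorem compl (h : IsSeparatingPair H x y A) :
    IsSeparatingPair H x y (Finset.univ \ insert x (insert y A)) where
  ne := h.ne
  nonempty := by
    obtain ⟨b, hb, hx, hy⟩ := h.exists_notMem
    exact ⟨b, by simp [hb, hx, hy]⟩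
  left_notMem := by simp
  right_notMem := by simp
  exists_notMem := by
    obtain ⟨a, ha⟩ := h.nonempty
    exact ⟨a, by simp [ha], fun e => h.left_notMem (e ▸ ha), fun e => h.right_notMem (e ▸ ha)⟩
  not_adj b hb a ha hx hy hab := by
    simp only [Finset.mem_sdiff, Finset.mem_univ, Finset.mem_insert, true_and, not_or]
      at ha hb
    exact h.not_adj a (by tauto) b hb.2.2 hb.1 hb.2.1 hab.symm

theorem deg_le (h : IsSeparatingPair H x y A) {a : V} (ha : a ∈ A) :
    deg H a ≤ A.card + 1 ∧
      (A.card + 1 ≤ deg H a → ∀ w, w ≠ a → (w ∈ A ∨ w = x ∨ w = y) → H.Adj a w) := by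
  classical
  have hsub : Finset.univ.filter (H.Adj a) ⊆ (insert x (insert y A)).erase a := by
    intro w hw
    have hw' := (Finset.mem_filter.1 hw).2
    refine Finset.mem_erase.2 ⟨hw'.ne', ?_⟩
    by_contra hn
    simp only [Finset.mem_insert, not_or] at hn
    exact h.not_adj a ha w hn.2.2 hn.1 hn.2.1 hw'
  have hcard : ((insert x (insert y A)).erase a).card = A.card + 1 := by
    rw [Finset.card_erase_of_mem (by simp [ha]), Finset.card_insert_of_notMem
      (by simp [h.left_notMem, h.ne]), Finset.card_insert_of_notMem h.right_notMem]
    rfl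
  rw [← degOn_univ, degOn, ← hcard]
  refine ⟨Finset.card_le_card hsub, fun hle w hwa hw => ?_⟩
  have := Finset.eq_of_subset_of_card_le hsub hle
  have hw' : w ∈ (insert x (insert y A)).erase a := by
    simp only [Finset.mem_erase, Finset.mem_insert]
    tauto
  rw [← this] at hw'
  exact (Finset.mem_filter.1 hw').2

/-- If nonadjacent vertices have degree sum `n`, each side of a separating pair `x`, `y` induces a
complete graph and is completely joined to `x` and `y`. -/
theorem adj (h : IsSeparatingPair H x y A)
    (hH : ∀ u w, u ≠ w → ¬ H.Adj u w → deg H u + deg H w = Fintype.card V)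
    {a : V} (ha : a ∈ A) {w : V} (hw : w ≠ a) (hw' : w ∈ A ∨ w = x ∨ w = y) : H.Adj a w := by
  obtain ⟨b, hb, hbx, hby⟩ := h.exists_notMem
  have h1 := (h.compl.deg_le (a := b) (by simp [hb, hbx, hby])).1
  have h2 := hH a b (fun e => hb (e ▸ ha)) (h.not_adj a ha b hb hbx hby)
  have h3 : (Finset.univ \ insert x (insert y A)).card + (A.card + 2) = Fintype.card V := by
    rw [← Finset.card_univ, ← Finset.card_sdiff_add_card_eq_card
      (Finset.subset_univ (insert x (insert y A))), Finset.card_insert_of_notMem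
      (by simp [h.left_notMem, h.ne]), Finset.card_insert_of_notMem h.right_notMem]
  exact (h.deg_le ha).2 (by omega) w hw hw'

theorem deg_eq_iff (h : IsSeparatingPair H x y A)
    (hH : ∀ u w, u ≠ w → ¬ H.Adj u w → deg H u + deg H w = Fintype.card V)
    (hn : 5 ≤ Fintype.card V) (z : V) : deg H z = Fintype.card V - 1 ↔ z = x ∨ z = y := by
  have hside : ∀ w, w ≠ x → w ≠ y → H.Adj w x ∧ H.Adj w y := by
    intro w hx hy
    by_cases hw : w ∈ A
    · exact ⟨h.adj hH hw hx.symm (by simp), h.adj hH hw hy.symm (by simp)⟩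
    · have hw' : w ∈ Finset.univ \ insert x (insert y A) := by simp [hw, hx, hy]
      exact ⟨h.compl.adj hH hw' hx.symm (by simp), h.compl.adj hH hw' hy.symm (by simp)⟩
  have hxy : H.Adj x y := by
    by_contra hna
    have hdeg : ∀ u w, u ≠ w → (∀ t, t ≠ u → t ≠ w → H.Adj u t) →
        Fintype.card V ≤ deg H u + 2 := by
      intro u w huw hut
      rw [← degOn_univ, degOn, ← Finset.card_univ]
      classical
      have hsub : (Finset.univ : Finset V) \ {u, w} ⊆ Finset.univ.filter (H.Adj u) := by
        intro t ht
        simp only [Finset.mem_sdiff, Finset.mem_insert, Finset.mem_singleton, not_or] at ht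
        exact Finset.mem_filter.2 ⟨Finset.mem_univ t, hut t ht.2.1 ht.2.2⟩
      have := Finset.card_le_card hsub
      rw [Finset.card_sdiff_of_subset (Finset.subset_univ _), Finset.card_pair huw] at this
      convert Nat.le_add_of_sub_le this
    have h1 := hdeg x y h.ne fun t hx hy => (hside t hx hy).1.symm
    have h2 := hdeg y x h.ne.symm fun t hy hx => (hside t hx hy).2.symm
    have h3 := hH x y h.ne hna
    omega
  rw [deg_eq_card_sub_one_iff]
  constructor
  · intro hz
    by_contra hn
    push Not at hn
    by_cases hzA : z ∈ A
    · obtain ⟨b, hb, hbx, hby⟩ := h.exists_notMem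
      exact h.not_adj z hzA b hb hbx hby (hz b fun e => hb (e ▸ hzA))
    · obtain ⟨a, ha⟩ := h.nonempty
      exact h.not_adj a ha z hzA hn.1 hn.2 (hz a fun e => hzA (e ▸ ha)).symm
  · rintro (rfl | rfl) w hw
    · by_cases hwy : w = y
      · exact hwy ▸ hxy
      · exact (hside w hw hwy).1.symm
    · by_cases hwx : w = x
      · exact hwx ▸ hxy.symm
      · exact (hside w hwx hw).2.symm

/-- No two nonadjacent vertices are both adjacent to `a`, so that `H - a` inherits Ore's
condition. -/
theorem hasSpanningCycle_erase_of_mem (h : IsSeparatingPair H x y A)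
    (hH : ∀ u w, u ≠ w → ¬ H.Adj u w → deg H u + deg H w = Fintype.card V)
    (hn : 5 ≤ Fintype.card V) {a : V} (ha : a ∈ A) :
    HasSpanningCycle H (Finset.univ.erase a) := by
  have hcard := card_univ_erase a
  refine hasSpanningCycle_of_ore (by omega) fun p hp q hq hpq hna => ?_
  have hpa := Finset.ne_of_mem_erase hp
  have hqa := Finset.ne_of_mem_erase hq
  have hsum := hH p q hpq hna
  have h1 := deg_le_degOn_erase_add_one H p a
  have h2 := deg_le_degOn_erase_add_one H q a
  by_cases hpadj : H.Adj p a
  · by_cases hqadj : H.Adj q a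
    · have hin : ∀ w, w ≠ a → H.Adj w a → w ∈ A ∨ w = x ∨ w = y := by
        intro w _ hwa
        by_contra hn
        push Not at hn
        exact h.not_adj a ha w hn.1 hn.2.1 hn.2.2 hwa.symm
      have hp' := hin p hpa hpadj
      have hq' := hin q hqa hqadj
      refine (hna ?_).elim
      by_cases hpA : p ∈ A
      · exact h.adj hH hpA hpq.symm hq'
      · exact (deg_eq_card_sub_one_iff p).1 ((h.deg_eq_iff hH hn p).2 (hp'.resolve_left hpA)) q
          hpq.symm
    · have := degOn_erase_of_not_adj hqadj
      omega
  · have := degOn_erase_of_not_adj hpadj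
    omega

theorem hasSpanningCycle_erase (h : IsSeparatingPair H x y A)
    (hH : ∀ u w, u ≠ w → ¬ H.Adj u w → deg H u + deg H w = Fintype.card V)
    (hn : 5 ≤ Fintype.card V) {a : V} (hx : a ≠ x) (hy : a ≠ y) :
    HasSpanningCycle H (Finset.univ.erase a) := by
  by_cases ha : a ∈ A
  · exact h.hasSpanningCycle_erase_of_mem hH hn ha
  · exact h.compl.hasSpanningCycle_erase_of_mem hH hn (by simp [ha, hx, hy])

theorem isHForceSet (h : IsSeparatingPair G x y A) :
    IsHForceSet G (Finset.univ \ {x, y}) := by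
  obtain ⟨a, ha⟩ := h.nonempty
  obtain ⟨b, hb, hbx, hby⟩ := h.exists_notMem
  have hax : a ≠ x := fun e => h.left_notMem (e ▸ ha)
  have hay : a ≠ y := fun e => h.right_notMem (e ▸ ha)
  refine ⟨⟨a, by simp [hax, hay]⟩, fun v c hc hs => isHamiltonianCycle_of_forall_mem hc ?_⟩
  have hs' : ∀ w, w ≠ x → w ≠ y → w ∈ c.support := fun w hx hy => hs w (by simp [hx, hy])
  have hxy := h.mem_support hc ha hb hbx hby (hs' a hax hay) (hs' b hbx hby)
  intro w
  by_cases hx : w = x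
  · exact hx ▸ hxy.1
  · by_cases hy : w = y
    · exact hy ▸ hxy.2
    · exact hs' w hx hy

end IsSeparatingPair

/-! ### The case of an independent set of half the vertices -/

theorem two_mul_card_le_of_isIndepSet (hham : HasSpanningCycle H Finset.univ) {I : Finset V}
    (hI : H.IsIndepSet I) : 2 * I.card ≤ Fintype.card V := by
  obtain ⟨v, c, hc, hs, -⟩ := hham.exists_isCycle
  exact (two_mul_card_le_length hc hI fun x _ => (hs x).2 (Finset.mem_univ x)).trans
    (isCycle_length_le hc)

theorem isHForceSet_of_isIndepSet [Nonempty V] {I : Finset V} (hI : G.IsIndepSet I)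
    (hcard : 2 * I.card = Fintype.card V) : IsHForceSet G I := by
  refine ⟨Finset.card_pos.1 ?_, fun v c hc hs => ?_⟩
  · have := Fintype.card_pos (α := V)
    omega
  · rw [SimpleGraph.Walk.isHamiltonianCycle_iff_isCycle_and_length_eq]
    have := two_mul_card_le_length hc hI hs
    exact ⟨hc, le_antisymm (isCycle_length_le hc) (by omega)⟩

theorem deg_le_card_sdiff {I : Finset V} (hI : H.IsIndepSet I) {a : V} (ha : a ∈ I) :
    deg H a ≤ (Finset.univ \ I).card ∧
      ((Finset.univ \ I).card ≤ deg H a → ∀ b ∉ I, H.Adj a b) := by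
  classical
  have hsub : Finset.univ.filter (H.Adj a) ⊆ Finset.univ \ I := by
    intro w hw
    have hw' := (Finset.mem_filter.1 hw).2
    exact Finset.mem_sdiff.2 ⟨Finset.mem_univ w, fun h => hI ha h hw'.ne hw'⟩
  rw [← degOn_univ, degOn]
  refine ⟨Finset.card_le_card hsub, fun hle b hb => ?_⟩
  have := Finset.eq_of_subset_of_card_le hsub hle
  have hb' : b ∈ Finset.univ \ I := by simp [hb]
  rw [← this] at hb'
  exact (Finset.mem_filter.1 hb').2

theorem card_sdiff_of_two_mul_card {I : Finset V} (hcard : 2 * I.card = Fintype.card V) :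
    (Finset.univ \ I).card = I.card := by
  rw [Finset.card_sdiff_of_subset (Finset.subset_univ I), Finset.card_univ]
  omega

theorem adj_of_isIndepSet
    (hH : ∀ u w, u ≠ w → ¬ H.Adj u w → deg H u + deg H w = Fintype.card V)
    (hn : 5 ≤ Fintype.card V) {I : Finset V} (hI : H.IsIndepSet I)
    (hcard : 2 * I.card = Fintype.card V) {a b : V} (ha : a ∈ I) (hb : b ∉ I) : H.Adj a b := by
  have hc := card_sdiff_of_two_mul_card hcard
  obtain ⟨a', ha', hne⟩ := Finset.exists_mem_ne (show 1 < I.card by omega) a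
  have h1 := hH a a' hne.symm (hI ha ha' hne.symm)
  have h2 := (deg_le_card_sdiff hI ha').1
  exact (deg_le_card_sdiff hI ha).2 (by omega) b hb

/-- If the complement of the independent set `I` spans an edge, then deleting a vertex of `I` keeps
the graph Hamiltonian. -/
theorem hasSpanningCycle_erase_of_isIndepSet
    (hH : ∀ u w, u ≠ w → ¬ H.Adj u w → deg H u + deg H w = Fintype.card V)
    (hn : 5 ≤ Fintype.card V) (hham : HasSpanningCycle H Finset.univ)
    (hsep : ∀ x y A, ¬ IsSeparatingPair H x y A) {I : Finset V} (hI : H.IsIndepSet I)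
    (hcard : 2 * I.card = Fintype.card V) {b b' : V} (hb : b ∉ I) (hb' : b' ∉ I)
    (hbb : H.Adj b b') {a : V} (ha : a ∈ I) : HasSpanningCycle H (Finset.univ.erase a) := by
  by_contra hv
  rcases separatingPair_or_indepSet hH hn hham hv with ⟨y, A, h⟩ | ⟨J, hJ, hJc, haJ⟩
  · exact hsep _ _ _ h
  · -- An independent set lies on one side of the complete join of `I` and its complement.
    by_cases hmeet : ∃ w ∈ J, w ∈ I
    · obtain ⟨w, hwJ, hwI⟩ := hmeet
      have hsub : J ⊆ I := by
        intro t ht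
        by_contra htI
        have := adj_of_isIndepSet hH hn hI hcard hwI htI
        exact hJ hwJ ht this.ne this
      have := Finset.eq_of_subset_of_card_le hsub (by omega)
      exact haJ (this ▸ ha)
    · push Not at hmeet
      have hsub : J ⊆ Finset.univ \ I := fun t ht => by simp [hmeet t ht]
      have hc := card_sdiff_of_two_mul_card hcard
      have := Finset.eq_of_subset_of_card_le hsub (by omega)
      have m1 : b ∈ J := by rw [this]; simp [hb]
      have m2 : b' ∈ J := by rw [this]; simp [hb']
      exact hJ m1 m2 hbb.ne hbb

/-- If `I` and its complement are both independent, then `G` is the complete bipartite graph between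
them, and it stays Hamiltonian if one vertex of each class is deleted. -/
theorem hasSpanningCycle_sdiff_pair (hG : IsOTG G) (hn : 5 ≤ Fintype.card V) {I : Finset V}
    (hI : G.IsIndepSet I) (hI' : G.IsIndepSet (Finset.univ \ I : Finset V))
    (hcard : 2 * I.card = Fintype.card V) {a b : V} (ha : a ∈ I) (hb : b ∉ I) :
    HasSpanningCycle G (Finset.univ \ {a, b}) := by
  classical
  have hab : a ≠ b := fun e => hb (e ▸ ha)
  have hc := card_sdiff_of_two_mul_card hcard
  have hmem : ∀ {w}, w ∉ I → w ∈ Finset.univ \ I := fun h => by simp [h]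
  have hII : Finset.univ \ (Finset.univ \ I) = I := by simp
  have hcross : ∀ p ∈ I, ∀ q ∉ I, G.Adj p q := by
    intro p hp q hq
    by_contra hna
    have h1 := deg_le_card_sdiff hI hp
    have h2 := (deg_le_card_sdiff hI' (hmem hq)).1
    rw [hII] at h2
    have h3 := hG p q (fun e => hq (e ▸ hp)) hna
    exact hna (h1.2 (by omega) q hq)
  have hS : (Finset.univ \ {a, b} : Finset V).card + 2 = Fintype.card V := by
    rw [Finset.card_sdiff_of_subset (Finset.subset_univ _), Finset.card_pair hab, Finset.card_univ]
    omega
  have hcompl : Finset.univ \ (Finset.univ \ {a, b} : Finset V) = {a, b} := by simp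
  have hloss : ∀ p, deg G p ≤ degOn G (Finset.univ \ {a, b}) p + 1 := by
    intro p
    have h1 := deg_le_degOn_add_card_sdiff G (Finset.univ \ {a, b}) p
    rw [hcompl] at h1
    refine h1.trans (Nat.add_le_add_left ?_ _)
    unfold degOn
    refine Finset.card_le_one.2 fun s hs t ht => ?_
    simp only [Finset.mem_filter, Finset.mem_insert, Finset.mem_singleton] at hs ht
    have hnot : ¬ (G.Adj p a ∧ G.Adj p b) := by
      rintro ⟨h1, h2⟩
      by_cases hp : p ∈ I
      · exact hI hp ha h1.ne h1
      · exact hI' (hmem hp) (hmem hb) h2.ne h2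
    rcases hs with ⟨rfl | rfl, hs⟩ <;> rcases ht with ⟨rfl | rfl, ht⟩ <;> tauto
  refine hasSpanningCycle_of_ore (by omega) fun p _ q _ hpq hna => ?_
  have h1 := hG p q hpq hna
  have h2 := hloss p
  have h3 := hloss q
  omega

/-- Every H-force set contains an independent set of the closure with `n / 2` vertices. -/
theorem IsHForceSet.exists_isIndepSet_subset (hG : IsOTG G) (hn : 5 ≤ Fintype.card V)
    (hW : IsWeakClosure G H) (hham : HasSpanningCycle H Finset.univ)
    (hsep : ∀ x y A, ¬ IsSeparatingPair H x y A) {I : Finset V} (hI : H.IsIndepSet I)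
    (hcard : 2 * I.card = Fintype.card V) {X : Finset V} (hX : IsHForceSet G X) :
    ∃ J ⊆ X, H.IsIndepSet J ∧ 2 * J.card = Fintype.card V := by
  have hH : ∀ u w, u ≠ w → ¬ H.Adj u w → deg H u + deg H w = Fintype.card V :=
    fun u w => hW.deg_add_deg hG
  by_cases hedge : ∃ b ∉ I, ∃ b' ∉ I, H.Adj b b'
  · obtain ⟨b, hb, b', hb', hbb⟩ := hedge
    refine ⟨I, fun a ha => hX.mem (hW.hasSpanningCycle_erase ?_), hI, hcard⟩
    exact hasSpanningCycle_erase_of_isIndepSet hH hn hham hsep hI hcard hb hb' hbb ha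
  · push Not at hedge
    have hI' : H.IsIndepSet (Finset.univ \ I : Finset V) := by
      intro p hp q hq _
      simp only [Finset.coe_sdiff, Finset.coe_univ, Set.mem_sdiff, Finset.mem_coe] at hp hq
      exact hedge p hp.2 q hq.2
    by_cases h1 : I ⊆ X
    · exact ⟨I, h1, hI, hcard⟩
    by_cases h2 : Finset.univ \ I ⊆ X
    · exact ⟨_, h2, hI', by rw [card_sdiff_of_two_mul_card hcard, hcard]⟩
    obtain ⟨a, ha, haX⟩ := Finset.not_subset.1 h1
    obtain ⟨b, hb, hbX⟩ := Finset.not_subset.1 h2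
    have hanti : ∀ {s : Set V}, H.IsIndepSet s → G.IsIndepSet s := fun h p hp q hq hne hadj =>
      h hp hq hne (hW.le hadj)
    have hS := hasSpanningCycle_sdiff_pair hG hn (hanti hI) (hanti hI') hcard ha
      (Finset.mem_sdiff.1 hb).2
    refine (hX.not_subset hS (fun he => ?_) fun w hw => ?_).elim
    · have := Finset.mem_univ a
      rw [← he] at this
      simp at this
    · simp only [Finset.mem_sdiff, Finset.mem_univ, Finset.mem_insert, Finset.mem_singleton,
        true_and, not_or]
      exact ⟨fun e => haX (e ▸ hw), fun e => hbX (e ▸ hw)⟩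

end HForce

/-! ### The minimum H-force sets in the three cases -/

theorem theorem2p2 {V : Type*} [Fintype V] [DecidableEq V] (G : SimpleGraph V)
    (hn : 5 ≤ Fintype.card V) (hG : HForce.IsOTG G) :
    G.IsHamiltonian ∧
    (HForce.hForceNumber G = Fintype.card V - 2 ∨
      2 * HForce.hForceNumber G = Fintype.card V ∨
      HForce.hForceNumber G = Fintype.card V) ∧
    (HForce.hForceNumber G = Fintype.card V - 2 →
      ∃ x y : V, x ≠ y ∧
        (∀ z : V, HForce.deg (HForce.weakClosure G) z = Fintype.card V - 1 ↔ z = x ∨ z = y) ∧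
        ∀ X : Finset V, HForce.IsMinHForceSet G X ↔ X = Finset.univ \ {x, y}) ∧
    (2 * HForce.hForceNumber G = Fintype.card V →
      ∀ X : Finset V, HForce.IsMinHForceSet G X ↔
        (HForce.weakClosure G).IsMaximumIndepSet X) ∧
    (HForce.hForceNumber G = Fintype.card V →
      ∀ X : Finset V, HForce.IsMinHForceSet G X ↔ X = Finset.univ) := by
  have hne : Nonempty V := Fintype.card_pos_iff.1 (by omega)
  have hW := HForce.weakClosure_spec G
  set H := HForce.weakClosure G
  have hham : HForce.HasSpanningCycle G Finset.univ := hG.hasSpanningCycle (by omega)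
  have hhamH : HForce.HasSpanningCycle H Finset.univ := hham.mono hW.le
  have hH : ∀ u w, u ≠ w → ¬ H.Adj u w → HForce.deg H u + HForce.deg H w = Fintype.card V :=
    fun u w => hW.deg_add_deg hG
  refine ⟨hham.isHamiltonian, ?_⟩
  by_cases hsep : ∃ x y A, HForce.IsSeparatingPair H x y A
  · obtain ⟨x, y, A, h⟩ := hsep
    have hmin := HForce.isMinHForceSet_iff_eq (h.anti hW.le).isHForceSet fun X hX v hv => by
      simp only [Finset.mem_sdiff, Finset.mem_univ, Finset.mem_insert, Finset.mem_singleton,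
        true_and, not_or] at hv
      exact hX.mem (hW.hasSpanningCycle_erase (h.hasSpanningCycle_erase hH hn hv.1 hv.2))
    have hnum : HForce.hForceNumber G = Fintype.card V - 2 := by
      rw [((hmin _).2 rfl).hForceNumber_eq, Finset.card_sdiff_of_subset (Finset.subset_univ _),
        Finset.card_pair h.ne, Finset.card_univ]
    exact ⟨Or.inl hnum, fun _ => ⟨x, y, h.ne, h.deg_eq_iff hH hn, hmin⟩,
      fun h2 => by omega, fun h2 => by omega⟩
  · push Not at hsep
    by_cases hind : ∃ I : Finset V, H.IsIndepSet I ∧ 2 * I.card = Fintype.card V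
    · obtain ⟨I, hI, hcard⟩ := hind
      have hforce : ∀ J : Finset V, H.IsIndepSet J → 2 * J.card = Fintype.card V →
          HForce.IsHForceSet G J := fun J hJ hJc =>
        HForce.isHForceSet_of_isIndepSet (fun p hp q hq hpq hadj => hJ hp hq hpq (hW.le hadj)) hJc
      have hsub := fun X (hX : HForce.IsHForceSet G X) =>
        hX.exists_isIndepSet_subset hG hn hW hhamH hsep hI hcard
      have hmin : ∀ X : Finset V, HForce.IsMinHForceSet G X ↔ H.IsMaximumIndepSet X := by
        intro X
        constructor
        · intro hX
          obtain ⟨J, hJX, hJ, hJc⟩ := hsub X hX.1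
          obtain rfl := Finset.eq_of_subset_of_card_le hJX (hX.2 J (hforce J hJ hJc))
          refine ⟨hJ, fun t ht => ?_⟩
          have := HForce.two_mul_card_le_of_isIndepSet hhamH ht
          omega
        · intro hX
          have h1 := hX.maximum I hI
          have h2 := HForce.two_mul_card_le_of_isIndepSet hhamH hX.isIndepSet
          refine ⟨hforce X hX.isIndepSet (by omega), fun Y hY => ?_⟩
          obtain ⟨J, hJY, -, hJc⟩ := hsub Y hY
          have := Finset.card_le_card hJY
          omega
      have hnum : 2 * HForce.hForceNumber G = Fintype.card V := by
        rw [((hmin I).2 ⟨hI, fun t ht => ?_⟩).hForceNumber_eq, hcard]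
        have := HForce.two_mul_card_le_of_isIndepSet hhamH ht
        omega
      exact ⟨Or.inr (Or.inl hnum), fun h2 => by omega, fun _ => hmin, fun h2 => by omega⟩
    · have hmin := HForce.isMinHForceSet_iff_eq (G := G) HForce.isHForceSet_univ fun X hX v _ => by
        refine hX.mem (hW.hasSpanningCycle_erase ?_)
        by_contra hv
        rcases HForce.separatingPair_or_indepSet hH hn hhamH hv with ⟨y, A, h⟩ | ⟨J, hJ, hJc, -⟩
        · exact hsep _ _ _ h
        · exact hind ⟨J, hJ, hJc⟩
      have hnum : HForce.hForceNumber G = Fintype.card V := by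
        rw [((hmin _).2 rfl).hForceNumber_eq, Finset.card_univ]
      exact ⟨Or.inr (Or.inr hnum), fun h2 => by omega, fun h2 => by omega, fun _ => hmin⟩
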